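/- **Theorem 1 ($(1-\delta)$-correctness of C-LUCB).** Let $K\ge 1$, $b>0$, $\delta>0$, and let $(R_1,\dots,R_K)$ be (possibly dependent) rewards with values in $[0,b]$ and means $\mu_k=\mathbb E[R_k]$, with a unique best arm $k^*$, i.e. $\mu_k<\mu_{k^*}$ for all $k\ne k^*$. Let $s_{\ell,k}$ be measurable pseudo-rewards, i.e. $\mathbb E[R_\ell\mid R_k=r]\le s_{\ell,k}(r)$ for almost every $r$ (with respect to the law of $R_k$), with $s_{\ell,\ell}(r)=r$. After $t$ rounds let $n_k(t)$ be the number of samples of arm $k$, and $\hat\phi_{\ell,k}(t)$ the average of $s_{\ell,k}(r)$ over the rewards $r$ received from arm $k$, so that $\hat\mu_k=\hat\phi_{k,k}$ is the empirical mean. Let $$B(n,\alpha)=\frac{1.7\,b}{2}\sqrt{\frac{\log\log(b^2n/2)+0.72\log(5.2/\alpha)}{n}}\quad\text{if } b^2n\ge 4,\qquad B(n,\alpha)=\infty\quad\text{otherwise},$$ and, with $\alpha=\delta/(2K)$, $$\tilde U_{\ell,k}(t)=\hat\phi_{\ell,k}(t)+B(n_k(t),\alpha),\quad \tilde U_\ell(t)=\min_k\tilde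 U_{\ell,k}(t),\quad L_k(t)=\hat\mu_k(t)-B(n_k(t),\alpha),\quad I_\ell(t)=\min_k\Big(\hat\phi_{\ell,k}(t)+b\sqrt{2\log t/n_k(t)}\Big),$$ where for $n_k(t)=0$ the terms $\tilde U_{\ell,k}(t)$ and $\hat\phi_{\ell,k}(t)+b\sqrt{2\log t/n_k(t)}$ are $+\infty$ and $L_k(t)=-\infty$. C-LUCB starts with the set $\mathcal A=\{1,\dots,K\}$ of active arms. It stops as soon as $|\mathcal A|=1$ and declares the arm in $\mathcal A$. While $|\mathcal A|>1$, in round $t+1$ it samples the two arms $m_1=\arg\max_{k\in\mathcal A}I_k(t)$ and $m_2=\arg\max_{k\in\mathcal A\setminus\{m_1\}}\min(\tilde U_{k,k}(t),I_k(t))$ (ties broken by any fixed rule), and then removes from $\mathcal A$ every arm $k$ with $\tilde U_k(t+1)<\max_{\ell\in\mathcal A}L_\ell(t+1)$. (If $\mathcal A$ ever becomes empty, the algorithm halts without declaring an arm.) The rewards of $m_1$ and $m_2$ in a round are read off two draws of $(R_1,\dots,R_K)$, which may depend on each other or be equal; the pairs of draws are independent over the rounds. Then, with probability at least $1-\delta$,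 C-LUCB stops and the arm that it declares is $k^*$. -/

import Mathlib

open MeasureTheory ProbabilityTheory

noncomputable section

namespace CLUCB

/-- The pseudo-rewards `s ℓ k` are valid for rewards in `[0, b]` with joint law `ν`:
`E[R_ℓ | R_k = r] ≤ s ℓ k r` for almost every `r` (with respect to the law of `R_k`), and
`s ℓ ℓ r = r` by convention. No bound on the values of `s` is required. -/
structure IsPseudoReward {K : ℕ} (b : ℝ) (ν : Measure (Fin K → ℝ))
    (s : Fin K → Fin K → ℝ → ℝ) : Prop where
  measurable : ∀ ℓ k, Measurable (s ℓ k)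
  self : ∀ ℓ, ∀ r ∈ Set.Icc (0 : ℝ) b, s ℓ ℓ r = r
  condExp_le : ∀ ℓ k,
    ν[(fun r : Fin K → ℝ => r ℓ) |
        MeasurableSpace.comap (fun r : Fin K → ℝ => r k) inferInstance]
      ≤ᵐ[ν] fun r => s ℓ k (r k)

/-- The width `B(n, α)` of the anytime confidence interval for `[0, b]`-valued rewards.
The formula is used in its range of validity, where the variance proxy `b² n / 4` of the sum of
`n` rewards is at least `1`; with fewer samples (in particular for `n = 0`) there is no
confidence statement yet, and the width is `∞`. -/
def confWidth (b : ℝ) (n : ℕ) (α : ℝ) : EReal :=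
  if 4 ≤ b ^ 2 * n then
    ((1.7 * b / 2 *
      √((Real.log (Real.log (b ^ 2 * n / 2)) + 0.72 * Real.log (5.2 / α)) / n) : ℝ) : EReal)
  else ⊤

/-- What the player knows at the end of a round. -/
@[ext]
structure State (K : ℕ) where
  /-- the set of active arms -/
  active : Finset (Fin K)
  /-- `count k` is the number of samples of arm `k` so far -/
  count : Fin K → ℕ
  /-- `total ℓ k` is the sum of `s ℓ k r` over the rewards `r` received from arm `k` so far -/
  total : Fin K → Fin K → ℝ

variable {K : ℕ}

/-- Before the first round: all arms are active and none has been sampled. -/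
def State.init (K : ℕ) : State K where
  active := Finset.univ
  count := fun _ => 0
  total := fun _ _ => 0

/-- Empirical pseudo-reward of arm `ℓ` with respect to arm `k`; for `ℓ = k` it is the empirical
mean of arm `k`. -/
def empPseudo (S : State K) (ℓ k : Fin K) : ℝ := S.total ℓ k / S.count k

/-- CrossUCB index of arm `ℓ` with respect to arm `k`. -/
def crossUCB (b α : ℝ) (S : State K) (ℓ k : Fin K) : EReal :=
  (empPseudo S ℓ k : EReal) + confWidth b (S.count k) α

/-- CrossUCB index of arm `ℓ`: the tightest of the `K` upper bounds. -/
def minCrossUCB (b α : ℝ) (S : State K) (ℓ : Fin K) : EReal := ⨅ k, crossUCB b α S ℓ k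

/-- Lower confidence index of arm `k`. -/
def lcb (b α : ℝ) (S : State K) (k : Fin K) : EReal :=
  (empPseudo S k k : EReal) - confWidth b (S.count k) α

/-- PseudoUCB index of arm `ℓ` with respect to arm `k` after `t` rounds; it is `∞` if arm `k`
has not been sampled. -/
def pseudoUCB (b : ℝ) (t : ℕ) (S : State K) (ℓ k : Fin K) : EReal :=
  if S.count k = 0 then ⊤
  else ((empPseudo S ℓ k + b * √(2 * Real.log t / S.count k) : ℝ) : EReal)

/-- PseudoUCB index of arm `ℓ`: the tightest of the `K` upper bounds. -/
def minPseudoUCB (b : ℝ) (t : ℕ) (S : State K) (ℓ : Fin K) : EReal := ⨅ k, pseudoUCB b t S ℓ k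

open Classical in
/-- The maximizers of `f` over `A`. -/
def argmaxSet (A : Finset (Fin K)) (f : Fin K → EReal) : Finset (Fin K) :=
  A.filter fun k => ∀ j ∈ A, f j ≤ f k

/-- A tie-breaking rule: in each round it picks an element of each nonempty set of arms. -/
def IsTieBreak (sel : ℕ → Finset (Fin K) → Fin K) : Prop :=
  ∀ t A, A.Nonempty → sel t A ∈ A

/-- The first arm sampled in round `t + 1`, from the state after `t` rounds. -/
def firstArm (b : ℝ) (sel : ℕ → Finset (Fin K) → Fin K) (t : ℕ) (S : State K) : Fin K :=
  sel t (argmaxSet S.active (minPseudoUCB b t S))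

/-- The second arm sampled in round `t + 1`, from the state after `t` rounds. -/
def secondArm (b δ : ℝ) (sel : ℕ → Finset (Fin K) → Fin K) (t : ℕ) (S : State K) : Fin K :=
  sel t (argmaxSet (S.active.erase (firstArm b sel t S))
    fun k => min (crossUCB b (δ / (2 * K)) S k k) (minPseudoUCB b t S k))

/-- Record the reward `r` received from arm `k`. -/
def State.observe (s : Fin K → Fin K → ℝ → ℝ) (S : State K) (k : Fin K) (r : ℝ) : State K where
  active := S.active
  count := fun j => if j = k then S.count j + 1 else S.count j
  total := fun ℓ j => if j = k then S.total ℓ j + s ℓ j r else S.total ℓ j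

open Classical in
/-- Remove every active arm whose CrossUCB index is below the largest lower confidence index of
the active arms. -/
def State.eliminate (b α : ℝ) (S : State K) : State K where
  active := S.active.filter fun k => ¬ minCrossUCB b α S k < S.active.sup (lcb b α S)
  count := S.count
  total := S.total

/-- Round `t + 1`. If more than one arm is active, two arms are sampled and arms are eliminated;
otherwise the algorithm has stopped and nothing changes any more. The first arm `m₁` gets the
reward `x 0 m₁` and the second arm `m₂` the reward `x 1 m₂`, where `x 0` and `x 1` are the two
reward vectors drawn in this round. -/
def step (b δ : ℝ) (s : Fin K → Fin K → ℝ → ℝ) (sel : ℕ → Finset (Fin K) → Fin K)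
    (t : ℕ) (x : Fin 2 → Fin K → ℝ) (S : State K) : State K :=
  if 1 < S.active.card then
    ((S.observe s (firstArm b sel t S) (x 0 (firstArm b sel t S))).observe s
      (secondArm b δ sel t S) (x 1 (secondArm b δ sel t S))).eliminate b (δ / (2 * K))
  else S

/-- The state after `t` rounds, when `x t` are the reward vectors drawn in round `t + 1`. -/
def run (b δ : ℝ) (s : Fin K → Fin K → ℝ → ℝ) (sel : ℕ → Finset (Fin K) → Fin K)
    (x : ℕ → Fin 2 → Fin K → ℝ) : ℕ → State K
  | 0 => State.init K
  | t + 1 => step b δ s sel t (x t) (run b δ s sel x t)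

/-- The algorithm stops, and declares arm `k`: after some round, `k` is the only active arm. -/
def StopsWith (b δ : ℝ) (s : Fin K → Fin K → ℝ → ℝ) (sel : ℕ → Finset (Fin K) → Fin K)
    (x : ℕ → Fin 2 → Fin K → ℝ) (k : Fin K) : Prop :=
  ∃ T, (run b δ s sel x T).active = {k}

end CLUCB

end

/-!
Write `α = δ / (2 K)` and `μ* = ∫ r, r kstar ∂ν`. The proof rests on the event that all confidence
bounds which matter are valid at all times: `μ* ≤ crossUCB kstar k` and `lcb k ≤ ∫ r, r k ∂ν` for
every arm `k`.

*Probability.* Each of these `2 K` families of bounds fails with probability at most `α`, so the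
event has probability at least `1 - δ`. For a fixed pair of arms, the exponential of
`l * (deviation) - l² / 2 * (b² n / 4)`, where `n` is the number of samples of arm `k`, is a
nonnegative supermartingale (`lintegral_expPotential_step_le`). For the rewards this is Hoeffding's
lemma; the pseudo-rewards `s kstar k` may be unbounded, but only their shortfall matters, and they
dominate a conditional expectation that is `[0, b]`-valued with mean `μ*`. Each arm is sampled at
most once in a round, so the dependence between the two draws of a round plays no role. Ville's
inequality (`measure_exists_le_recursion`) bounds the probability that the supermartingale ever
becomes large. Splitting the range of the variance proxy `v = b² n / 4 ≥ 1` into the epochs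
`[2 ^ i, 2 ^ (i + 1))`, with one value of `l` and a share `∝ (i + 1) ^ (-1.4)` of `α` for each
epoch, the linear boundaries of the epochs all stay below the iterated-logarithm boundary of
`confWidth` (`log_le_of_boundary_le`), and a union bound over the epochs gives
`measure_exists_boundary_le_le`.

*Termination.* On the event, `stopsWith_of_bounds` is deterministic. The best arm is never
eliminated. If the algorithm never stopped, at least two arms would be sampled infinitely often,
and for each of them the width of the interval would tend to `0`. If the best arm is one of them,
then its lower index eventually exceeds the upper index of another one of them, which is
eliminated and cannot be sampled any more. If it is not, then some suboptimal arm is the second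
choice infinitely often; its upper index tends to at most its mean, whereas both indices of the
best arm eventually exceed a number between this mean and `μ*`, so that the best arm would have
been preferred. No law of large numbers is needed: the event itself says that the relevant
estimates converge.
-/

noncomputable section

namespace CLUCB

/-! ### Weights of the epochs and numerical estimates -/

/-- The midpoint inequality for the integral of the convex function `x ↦ x ^ (-1.4)` over
`[1 - u, 1 + u]`. -/
lemma rpow_midpoint {u : ℝ} (hu0 : 0 ≤ u) (hu1 : u < 1) :
    0.8 * u ≤ (1 - u) ^ (-0.4 : ℝ) - (1 + u) ^ (-0.4 : ℝ) := by
  have hmono : MonotoneOn (fun u : ℝ => (1 - u) ^ (-0.4 : ℝ) - (1 + u) ^ (-0.4 : ℝ) - 0.8 * u)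
      (Set.Ico 0 1) := by
    have hd : ∀ x ∈ Set.Ico (0 : ℝ) 1, HasDerivAt
        (fun u : ℝ => (1 - u) ^ (-0.4 : ℝ) - (1 + u) ^ (-0.4 : ℝ) - 0.8 * u)
        (-1 * (-0.4) * (1 - x) ^ (-0.4 - 1 : ℝ) - 1 * (-0.4) * (1 + x) ^ (-0.4 - 1 : ℝ)
          - 0.8 * 1) x := by
      intro x hx
      have h1 : HasDerivAt (fun u : ℝ => 1 - u) (-1) x := by
        simpa using (hasDerivAt_id x).const_sub 1
      have h2 : HasDerivAt (fun u : ℝ => 1 + u) 1 x := by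
        simpa using (hasDerivAt_id x).const_add 1
      exact ((h1.rpow_const (Or.inl (by linarith [hx.2]))).sub
        (h2.rpow_const (Or.inl (by linarith [hx.1])))).sub ((hasDerivAt_id x).const_mul 0.8)
    refine monotoneOn_of_deriv_nonneg (convex_Ico 0 1)
      (fun x hx => (hd x hx).continuousAt.continuousWithinAt)
      (fun x hx => (hd x (interior_subset hx)).differentiableAt.differentiableWithinAt) ?_
    intro x hx
    have hx' := interior_subset hx
    rw [(hd x hx').deriv]
    have e1 : 0 < 1 - x := by linarith [hx'.2]
    have e2 : 0 < 1 + x := by linarith [hx'.1]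
    set p := (1 - x) ^ (-0.4 - 1 : ℝ)
    set q := (1 + x) ^ (-0.4 - 1 : ℝ)
    have hp : 0 < p := Real.rpow_pos_of_pos e1 _
    have hq : 0 < q := Real.rpow_pos_of_pos e2 _
    -- arithmetic-geometric mean: the product of the two powers is at least one
    have hpq : 1 ≤ p * q := by
      rw [← Real.mul_rpow e1.le e2.le]
      exact Real.one_le_rpow_of_pos_of_le_one_of_nonpos (by positivity) (by nlinarith [hx'.1])
        (by norm_num)
    nlinarith [sq_nonneg (p - q), sq_nonneg (p + q - 2)]
  have := hmono (Set.left_mem_Ico.2 one_pos) ⟨hu0, hu1⟩ hu0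
  norm_num at this
  norm_num
  linarith

/-- The share of the error probability spent on the epoch `[2 ^ k, 2 ^ (k + 1))` of the variance
proxy. The exponent `1.4` is about `1 / 0.72`, and `3.13` is an upper bound for `ζ(1.4)`. -/
def epochWeight (k : ℕ) : ℝ := ((k : ℝ) + 1) ^ (-1.4 : ℝ) / 3.13

lemma epochWeight_pos (k : ℕ) : 0 < epochWeight k := by unfold epochWeight; positivity

/-- A term of the series of `ζ(1.4)` is at most the integral of `x ^ (-1.4)` over the unit interval
centred at it. -/
lemma rpow_le_telescope (k : ℕ) (hk : 1 ≤ k) : ((k : ℝ) + 1) ^ (-1.4 : ℝ) ≤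
    2.5 * (((k : ℝ) + 1 / 2) ^ (-0.4 : ℝ) - ((k : ℝ) + 1 + 1 / 2) ^ (-0.4 : ℝ)) := by
  have hk' : (1 : ℝ) ≤ k := by exact_mod_cast hk
  have hpos : (0 : ℝ) < k + 1 := by positivity
  have h := rpow_midpoint (u := 1 / (2 * ((k : ℝ) + 1))) (by positivity)
    (by rw [div_lt_one (by positivity)]; linarith)
  have e1 : (k : ℝ) + 1 / 2 = (k + 1) * (1 - 1 / (2 * ((k : ℝ) + 1))) := by field_simp; ring
  have e2 : (k : ℝ) + 1 + 1 / 2 = (k + 1) * (1 + 1 / (2 * ((k : ℝ) + 1))) := by field_simp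
  have e3 : ((k : ℝ) + 1) ^ (-1.4 : ℝ) = (k + 1) ^ (-0.4 : ℝ) * (1 / ((k : ℝ) + 1)) := by
    rw [show (-1.4 : ℝ) = -0.4 - 1 by norm_num, Real.rpow_sub_one hpos.ne']; ring
  have hu : 1 / (2 * ((k : ℝ) + 1)) ≤ 1 := by
    rw [div_le_one (by positivity)]; linarith
  rw [e1, e2, e3, Real.mul_rpow hpos.le (by linarith), Real.mul_rpow hpos.le (by positivity)]
  have hP : 0 < ((k : ℝ) + 1) ^ (-0.4 : ℝ) := by positivity
  have e4 : 1 / ((k : ℝ) + 1) = 2 * (1 / (2 * ((k : ℝ) + 1))) := by field_simp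
  rw [e4]
  nlinarith [mul_le_mul_of_nonneg_left h hP.le]

/-- This says `ζ(1.4) ≤ 3.13`. -/
lemma sum_epochWeight_le (N : ℕ) : ∑ k ∈ Finset.range N, epochWeight k ≤ 1 := by
  have key : ∀ N : ℕ, ∑ k ∈ Finset.range (N + 1), ((k : ℝ) + 1) ^ (-1.4 : ℝ)
      ≤ 1 + 2.5 * (1.5 ^ (-0.4 : ℝ) - ((N : ℝ) + 1 + 1 / 2) ^ (-0.4 : ℝ)) := by
    intro N
    induction N with
    | zero => norm_num
    | succ N ih =>
      rw [Finset.sum_range_succ]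
      have := rpow_le_telescope (N + 1) (by omega)
      push_cast at this ⊢
      linarith
  have hnum : (1.5 : ℝ) ^ (-0.4 : ℝ) ≤ 0.852 := by
    have h5 : ((1.5 : ℝ) ^ (-0.4 : ℝ)) ^ 5 ≤ 0.852 ^ 5 := by
      rw [← Real.rpow_natCast, ← Real.rpow_mul (by norm_num)]
      norm_num
    exact le_of_pow_le_pow_left₀ (by norm_num) (by norm_num) h5
  unfold epochWeight
  rw [← Finset.sum_div, div_le_one (by norm_num)]
  calc ∑ k ∈ Finset.range N, ((k : ℝ) + 1) ^ (-1.4 : ℝ)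
      ≤ ∑ k ∈ Finset.range (N + 1), ((k : ℝ) + 1) ^ (-1.4 : ℝ) :=
        Finset.sum_le_sum_of_subset_of_nonneg (Finset.range_subset_range.2 (by omega))
          fun i _ _ => by positivity
    _ ≤ _ := key N
    _ ≤ 3.13 := by
        have : 0 < ((N : ℝ) + 1 + 1 / 2) ^ (-0.4 : ℝ) := by positivity
        norm_num at hnum this ⊢
        linarith

lemma log_num_upper : Real.log 3.13 ≤ 1.1415 := by
  rw [Real.log_le_iff_le_exp (by norm_num)]
  refine le_trans ?_ (Real.sum_le_exp_of_nonneg (by norm_num) 9)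
  norm_num [Finset.sum_range_succ, Nat.factorial]

lemma log_num_lower : 1.648 ≤ Real.log 5.2 := by
  rw [Real.le_log_iff_exp_le (by norm_num)]
  have h := Real.exp_bound' (x := 0.824) (by norm_num) (by norm_num) (n := 7) (by norm_num)
  rw [show (1.648 : ℝ) = 0.824 + 0.824 by norm_num, Real.exp_add]
  have h2 : Real.exp 0.824 ≤ 2.2801 := by
    refine h.trans ?_
    norm_num [Finset.sum_range_succ, Nat.factorial]
  nlinarith [Real.exp_pos 0.824]

lemma loglog_two_lower : -0.3667 ≤ Real.log (Real.log 2) := by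
  rw [Real.le_log_iff_exp_le (Real.log_pos (by norm_num)), Real.exp_neg]
  refine le_trans ?_ Real.log_two_gt_d9.le
  have h := Real.sum_le_exp_of_nonneg (x := 0.3667) (by norm_num) 6
  rw [inv_le_comm₀ (Real.exp_pos _) (by norm_num)]
  refine le_trans ?_ h
  norm_num [Finset.sum_range_succ, Nat.factorial]

/-! ### The stitched boundary -/

lemma log_inv_mul_epochWeight {α : ℝ} (hα : 0 < α) (k : ℕ) :
    Real.log (1 / (α * epochWeight k))
      = Real.log (1 / α) + 1.4 * Real.log ((k : ℝ) + 1) + Real.log 3.13 := by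
  have hk : (0 : ℝ) < k + 1 := by positivity
  unfold epochWeight
  rw [one_div, one_div, Real.log_inv, Real.log_inv, Real.log_mul hα.ne' (by positivity),
    Real.log_div (by positivity) (by norm_num), Real.log_rpow hk]
  ring

lemma log_inv_mul_epochWeight_pos {α : ℝ} (hα : 0 < α) (hα1 : α < 1) (k : ℕ) :
    0 < Real.log (1 / (α * epochWeight k)) := by
  rw [log_inv_mul_epochWeight hα]
  have h1 : 0 < Real.log (1 / α) := Real.log_pos (by rw [one_div]; exact (one_lt_inv₀ hα).2 hα1)
  have h2 : 0 ≤ Real.log ((k : ℝ) + 1) := Real.log_nonneg (by linarith [k.cast_nonneg (α := ℝ)])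
  have h3 : 0 < Real.log 3.13 := Real.log_pos (by norm_num)
  linarith

/-- The log-level of an epoch is at most the expression under the root in the boundary. The factor
`1 + 3 / 4 * √2` is the largest value of `(√(v / v₀) + √(v₀ / v))² / 2` over an epoch with geometric
midpoint `v₀`; it is the price of a linear boundary. The constants match because
`1.4 * (1 + 3 / 4 * √2) ≤ 1.7²`, `1 + 3 / 4 * √2 ≤ 0.72 * 1.7²` and
`(1 + 3 / 4 * √2) * log (3.13 / log 2 ^ 1.4) ≤ 0.72 * 1.7² * log 5.2`, the last with enough
room for the negative term `(1.7² - 1.4 * (1 + 3 / 4 * √2)) * log (log 2)` that is left over. -/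
lemma log_epoch_le_boundary {α v : ℝ} (hα : 0 < α) (hα1 : α < 1) {k : ℕ} (hv : 2 ^ k ≤ v) :
    (1 + 3 / 4 * √2) * Real.log (1 / (α * epochWeight k))
      ≤ 1.7 ^ 2 * (Real.log (Real.log (2 * v)) + 0.72 * Real.log (5.2 / α)) := by
  have hk : (0 : ℝ) < k + 1 := by positivity
  have hl2 : 0 < Real.log 2 := Real.log_pos (by norm_num)
  have hy : Real.log ((k : ℝ) + 1) + Real.log (Real.log 2) ≤ Real.log (Real.log (2 * v)) := by
    rw [← Real.log_mul hk.ne' hl2.ne']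
    refine Real.log_le_log (by positivity) ?_
    have : ((k : ℝ) + 1) * Real.log 2 = Real.log (2 ^ (k + 1)) := by
      rw [Real.log_pow]; push_cast; ring
    rw [this]
    exact Real.log_le_log (by positivity) (by rw [pow_succ]; linarith)
  have hs : √2 ≤ 1.41422 := by
    rw [Real.sqrt_le_left (by norm_num)]; norm_num
  have hc : 1 + 3 / 4 * √2 ≤ 2.0607 := by linarith
  have h2 : 0 ≤ Real.log ((k : ℝ) + 1) := Real.log_nonneg (by linarith [k.cast_nonneg (α := ℝ)])
  have h1 : 0 < Real.log (1 / α) := Real.log_pos (by rw [one_div]; exact (one_lt_inv₀ hα).2 hα1)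
  have h52 : Real.log (5.2 / α) = Real.log 5.2 + Real.log (1 / α) := by
    rw [one_div, Real.log_inv, Real.log_div (by norm_num) hα.ne']; ring
  refine (mul_le_mul_of_nonneg_right hc (log_inv_mul_epochWeight_pos hα hα1 k).le).trans ?_
  rw [log_inv_mul_epochWeight hα, h52]
  linarith [log_num_upper, log_num_lower, loglog_two_lower]

/-- The slope of the linear boundary used in epoch `k`: it makes the boundary tangent to the
parabola `v ↦ √(2 L v)` at the geometric midpoint `2 ^ k * √2` of the epoch, where `L` is the
log-level `log (1 / (α * epochWeight k))` of the epoch. -/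
def epochSlope (α : ℝ) (k : ℕ) : ℝ := √(√2 * Real.log (1 / (α * epochWeight k)) / 2 ^ k)

/-- The worst case over the epoch `[p, 2 p]` is attained at both of its end points. -/
lemma linear_boundary_le {l p v D : ℝ} (hl : 0 < l) (hp : 0 < p) (hv1 : p ≤ v) (hv2 : v ≤ 2 * p)
    (hD0 : 0 ≤ D) (hD : (1 + 3 / 4 * √2) * l * v ≤ D ^ 2) :
    l ≤ √(√2 * l / p) * D - √(√2 * l / p) ^ 2 * v / 2 := by
  have hs0 : 0 < √2 := by positivity
  have hss : √2 * √2 = 2 := Real.mul_self_sqrt (by norm_num)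
  have hy : 0 < √2 * l / p := by positivity
  set y := √2 * l / p with hydef
  set x := √y with hx
  have hx0 : 0 < x := Real.sqrt_pos.2 hy
  have hxx : x ^ 2 = y := Real.sq_sqrt hy.le
  rw [hxx]
  have hle : (l + y * v / 2) ^ 2 ≤ (x * D) ^ 2 := by
    rw [mul_pow, hxx]
    refine le_trans ?_ (mul_le_mul_of_nonneg_left hD hy.le)
    have hl' : l = y * p * √2 / 2 := by
      rw [hydef]; field_simp; nlinarith
    -- the slack of the squared inequality is a positive multiple of `(v - p) * (2 * p - v)`
    have hq : (v - p) * (v - 2 * p) ≤ 0 :=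
      mul_nonpos_of_nonneg_of_nonpos (by linarith) (by linarith)
    rw [hl']
    have e : y * ((1 + 3 / 4 * √2) * (y * p * √2 / 2) * v) - (y * p * √2 / 2 + y * v / 2) ^ 2
        = y ^ 2 * (-((v - p) * (v - 2 * p))) / 4
          + (√2 * √2 - 2) * (y ^ 2 * (3 / 8 * p * v - p ^ 2 / 4)) := by ring
    rw [hss, sub_self, zero_mul, add_zero] at e
    have : 0 ≤ y ^ 2 * (-((v - p) * (v - 2 * p))) / 4 := by
      have := neg_nonneg.2 hq
      positivity
    linarith
  have := le_of_sq_le_sq hle (by positivity)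
  linarith

/-- The stitched boundary dominates the linear boundary of each epoch. -/
lemma log_le_of_boundary_le {α v D : ℝ} (hα : 0 < α) (hα1 : α < 1) {k : ℕ} (hv1 : 2 ^ k ≤ v)
    (hv2 : v ≤ 2 ^ (k + 1))
    (hD : 1.7 * √(v * (Real.log (Real.log (2 * v)) + 0.72 * Real.log (5.2 / α))) ≤ D) :
    Real.log (1 / (α * epochWeight k)) ≤ epochSlope α k * D - epochSlope α k ^ 2 * v / 2 := by
  have hL := log_inv_mul_epochWeight_pos hα hα1 k
  have hb := log_epoch_le_boundary hα hα1 hv1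
  have hv0 : 0 < v := lt_of_lt_of_le (by positivity) hv1
  set Q := Real.log (Real.log (2 * v)) + 0.72 * Real.log (5.2 / α)
  have hQ : 0 ≤ Q := by
    have : 0 < (1 + 3 / 4 * √2) * Real.log (1 / (α * epochWeight k)) := by positivity
    nlinarith
  refine linear_boundary_le hL (by positivity) hv1 (by rw [pow_succ] at hv2; linarith)
    (le_trans (by positivity) hD) ?_
  calc (1 + 3 / 4 * √2) * Real.log (1 / (α * epochWeight k)) * v
      ≤ 1.7 ^ 2 * Q * v := mul_le_mul_of_nonneg_right hb hv0.le
    _ = (1.7 * √(v * Q)) ^ 2 := by rw [mul_pow, Real.sq_sqrt (by positivity)]; ring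
    _ ≤ D ^ 2 := pow_le_pow_left₀ (by positivity) hD 2

/-! ### Measurability of the algorithm -/

section

variable {K : ℕ}

/-- The discrete σ-algebra on the finite type of sets of arms. -/
instance armSetMeasurableSpace : MeasurableSpace (Finset (Fin K)) := ⊤

/-- The σ-algebra on states generated by the active set, the counts and the totals. -/
instance stateMeasurableSpace : MeasurableSpace (State K) :=
  MeasurableSpace.comap (fun S => (S.active, S.count, S.total)) inferInstance

lemma measurable_state_tuple :
    Measurable fun S : State K => (S.active, S.count, S.total) := comap_measurable _

lemma measurable_active : Measurable fun S : State K => S.active :=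
  measurable_state_tuple.fst

@[fun_prop]
lemma measurable_count (k : Fin K) : Measurable fun S : State K => S.count k :=
  (measurable_pi_apply k).comp measurable_state_tuple.snd.fst

@[fun_prop]
lemma measurable_total (ℓ k : Fin K) : Measurable fun S : State K => S.total ℓ k :=
  (measurable_pi_apply k).comp ((measurable_pi_apply ℓ).comp measurable_state_tuple.snd.snd)

lemma measurable_to_state {Y : Type*} [MeasurableSpace Y] {f : Y → State K}
    (h1 : Measurable fun y => (f y).active) (h2 : ∀ k, Measurable fun y => (f y).count k)
    (h3 : ∀ ℓ k, Measurable fun y => (f y).total ℓ k) : Measurable f :=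
  measurable_comap_iff.2 (h1.prodMk ((measurable_pi_iff.2 h2).prodMk
    (measurable_pi_iff.2 fun ℓ => measurable_pi_iff.2 (h3 ℓ))))

lemma measurable_to_finset {Y : Type*} [MeasurableSpace Y] {f : Y → Finset (Fin K)}
    (h : ∀ k, MeasurableSet {y | k ∈ f y}) : Measurable f := by
  refine measurable_to_countable' fun A => ?_
  have : f ⁻¹' {A} = ⋂ k, {y | k ∈ f y ↔ k ∈ A} := by
    ext y; simp [Finset.ext_iff]
  rw [this]
  exact MeasurableSet.iInter fun k => (h k).iff (MeasurableSet.const _)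

lemma measurableSet_mem_active (k : Fin K) : MeasurableSet {S : State K | k ∈ S.active} :=
  measurable_active (show MeasurableSet {A : Finset (Fin K) | k ∈ A} from trivial)

lemma measurable_confWidth (b α : ℝ) : Measurable fun n : ℕ => confWidth b n α :=
  measurable_of_countable _

lemma measurable_empPseudo (ℓ k : Fin K) : Measurable fun S : State K => empPseudo S ℓ k := by
  have : Measurable fun S : State K => (S.count k : ℝ) :=
    (measurable_of_countable (fun n : ℕ => (n : ℝ))).comp (measurable_count k)
  exact (measurable_total ℓ k).div this

lemma measurable_crossUCB (b α : ℝ) (ℓ k : Fin K) :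
    Measurable fun S : State K => crossUCB b α S ℓ k :=
  (measurable_empPseudo ℓ k).coe_real_ereal.add
    ((measurable_confWidth b α).comp (measurable_count k))

lemma measurable_minCrossUCB (b α : ℝ) (ℓ : Fin K) :
    Measurable fun S : State K => minCrossUCB b α S ℓ :=
  Measurable.iInf fun k => measurable_crossUCB b α ℓ k

lemma measurable_lcb (b α : ℝ) (k : Fin K) : Measurable fun S : State K => lcb b α S k :=
  (measurable_empPseudo k k).coe_real_ereal.add
    ((measurable_of_countable (fun n : ℕ => -confWidth b n α)).comp (measurable_count k))

lemma measurable_minPseudoUCB (b : ℝ) (t : ℕ) (ℓ : Fin K) :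
    Measurable fun S : State K => minPseudoUCB b t S ℓ := by
  refine Measurable.iInf fun k => Measurable.ite ?_ measurable_const ?_
  · exact measurable_count k (measurableSet_singleton 0)
  · exact ((measurable_empPseudo ℓ k).add
      ((measurable_of_countable (fun n : ℕ => b * √(2 * Real.log t / n))).comp
        (measurable_count k))).coe_real_ereal

lemma measurable_argmaxSet {Y : Type*} [MeasurableSpace Y] {A : Y → Finset (Fin K)}
    {f : Y → Fin K → EReal} (hA : Measurable A) (hf : ∀ k, Measurable fun y => f y k) :
    Measurable fun y => argmaxSet (A y) (f y) := by
  have hmem : ∀ k, MeasurableSet {y | k ∈ A y} := fun k =>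
    hA (show MeasurableSet {B : Finset (Fin K) | k ∈ B} from trivial)
  refine measurable_to_finset fun k => ?_
  have : {y | k ∈ argmaxSet (A y) (f y)}
      = {y | k ∈ A y} ∩ ⋂ j, {y | j ∈ A y → f y j ≤ f y k} := by
    ext y; simp [argmaxSet]
  rw [this]
  exact (hmem k).inter (MeasurableSet.iInter fun j =>
    (hmem j).imp (measurableSet_le (hf j) (hf k)))

variable (b δ : ℝ) {s : Fin K → Fin K → ℝ → ℝ} (sel : ℕ → Finset (Fin K) → Fin K)

lemma measurable_firstArm (t : ℕ) : Measurable fun S : State K => firstArm b sel t S :=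
  (measurable_of_countable (sel t)).comp
    (measurable_argmaxSet measurable_active fun k => measurable_minPseudoUCB b t k)

lemma measurable_secondArm (t : ℕ) : Measurable fun S : State K => secondArm b δ sel t S := by
  refine (measurable_of_countable (sel t)).comp (measurable_argmaxSet ?_ fun k => ?_)
  · exact (measurable_of_countable
      (fun p : Finset (Fin K) × Fin K => p.1.erase p.2)).comp
      (measurable_active.prodMk (measurable_firstArm b sel t))
  · exact (measurable_crossUCB b _ k k).min (measurable_minPseudoUCB b t k)

/-- The arm that is observed may depend on the state, as long as its choice is measurable. -/
lemma measurable_observe (hs : ∀ ℓ k, Measurable (s ℓ k)) {Y : Type*} [MeasurableSpace Y]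
    {S : Y → State K} {m : Y → Fin K} {x : Y → Fin K → ℝ} (hS : Measurable S) (hm : Measurable m)
    (hx : ∀ k, Measurable fun y => x y k) :
    Measurable fun y => (S y).observe s (m y) (x y (m y)) := by
  have heq : ∀ j, MeasurableSet {y | j = m y} := fun j =>
    measurableSet_eq_fun measurable_const hm
  refine measurable_to_state (show Measurable fun y => (S y).active from measurable_active.comp hS)
    (fun j => ?_) fun ℓ j => ?_
  · exact Measurable.ite (heq j) (((measurable_count j).comp hS).add_const 1)
      ((measurable_count j).comp hS)
  · have : (fun y => ((S y).observe s (m y) (x y (m y))).total ℓ j)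
        = fun y => if j = m y then (S y).total ℓ j + s ℓ j (x y j) else (S y).total ℓ j := by
      funext y
      by_cases h : j = m y
      · subst h; simp [State.observe]
      · simp [State.observe, h]
    rw [this]
    exact Measurable.ite (heq j)
      (((measurable_total ℓ j).comp hS).add ((hs ℓ j).comp (hx j)))
      ((measurable_total ℓ j).comp hS)

lemma measurable_eliminate (α : ℝ) : Measurable fun S : State K => S.eliminate b α := by
  refine measurable_to_state (measurable_to_finset fun k => ?_) measurable_count measurable_total
  have : {S : State K | k ∈ (S.eliminate b α).active} = {S | k ∈ S.active} ∩
      (⋃ j, {S | j ∈ S.active} ∩ {S | minCrossUCB b α S k < lcb b α S j})ᶜ := by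
    ext S
    simp [State.eliminate, Finset.lt_sup_iff]
  rw [this]
  exact (measurableSet_mem_active k).inter (MeasurableSet.iUnion fun j =>
    (measurableSet_mem_active j).inter
      (measurableSet_lt (measurable_minCrossUCB b α k) (measurable_lcb b α j))).compl

lemma measurable_step (hs : ∀ ℓ k, Measurable (s ℓ k)) (t : ℕ) :
    Measurable fun p : State K × (Fin 2 → Fin K → ℝ) => step b δ s sel t p.2 p.1 := by
  have hx : ∀ i k, Measurable fun p : State K × (Fin 2 → Fin K → ℝ) => p.2 i k := by
    intro i k; fun_prop
  refine Measurable.ite ?_ ?_ measurable_fst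
  · exact (measurable_active.comp measurable_fst)
      (show MeasurableSet {A : Finset (Fin K) | 1 < A.card} from trivial)
  · exact (measurable_eliminate b _).comp (measurable_observe hs
      (measurable_observe hs measurable_fst
        ((measurable_firstArm b sel t).comp measurable_fst) (hx 0))
      ((measurable_secondArm b δ sel t).comp measurable_fst) (hx 1))

end

/-! ### Ville's inequality and Hoeffding's lemma -/

section

section RandomRecursion

variable {E Y : Type*}

/-- The state after `t` steps of the recursion `y ↦ F t (x t) y`, started at `y₀` and driven by
the inputs `x`. -/
def recursion (F : ℕ → E → Y → Y) (y₀ : Y) (x : ℕ → E) : ℕ → Y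
  | 0 => y₀
  | t + 1 => F t (x t) (recursion F y₀ x t)

lemma recursion_congr {F : ℕ → E → Y → Y} {y₀ : Y} {x x' : ℕ → E} {t : ℕ}
    (h : ∀ u < t, x u = x' u) : recursion F y₀ x t = recursion F y₀ x' t := by
  induction t with
  | zero => rfl
  | succ t ih => rw [recursion, recursion, ih fun u hu => h u (by omega), h t (by omega)]

variable [MeasurableSpace E] [MeasurableSpace Y]

lemma measurable_recursion {F : ℕ → E → Y → Y} (hF : ∀ t, Measurable fun p : Y × E => F t p.2 p.1)
    (y₀ : Y) (t : ℕ) : Measurable fun x : ℕ → E => recursion F y₀ x t := by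
  induction t with
  | zero => exact measurable_const
  | succ t ih => exact (hF t).comp (ih.prodMk (measurable_pi_apply t))

variable {Ω : Type*} [MeasurableSpace Ω] {P : Measure Ω} {W : ℕ → Ω → E} {F : ℕ → E → Y → Y}

/-- The state after `t` steps is independent of the input of step `t + 1`. -/
lemma indepFun_recursion [IsProbabilityMeasure P]
    (hF : ∀ t, Measurable fun p : Y × E => F t p.2 p.1)
    (hW : ∀ t, Measurable (W t)) (hind : iIndepFun W P) (y₀ : Y) (t : ℕ) :
    IndepFun (fun ω => recursion F y₀ (fun u => W u ω) t) (W t) P := by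
  obtain ⟨ω₀⟩ := nonempty_of_isProbabilityMeasure P
  have h := hind.indepFun_finset (Finset.range t) {t} (by simp) hW
  let ext : ((u : Finset.range t) → E) → ℕ → E :=
    fun p u => if hu : u ∈ Finset.range t then p ⟨u, hu⟩ else W u ω₀
  have hext : Measurable ext := by
    refine measurable_pi_iff.2 fun u => ?_
    by_cases hu : u ∈ Finset.range t
    · simp only [ext, dif_pos hu]
      exact measurable_pi_apply (⟨u, hu⟩ : Finset.range t)
    · simp only [ext, dif_neg hu]
      exact measurable_const
  have := h.comp ((measurable_recursion hF y₀ t).comp hext)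
    (measurable_pi_apply (⟨t, Finset.mem_singleton_self t⟩ : ({t} : Finset ℕ)))
  have hrec : (fun ω => recursion F y₀ (fun u => W u ω) t) =
      ((fun x => recursion F y₀ x t) ∘ ext) ∘ fun ω (u : Finset.range t) => W u ω := by
    funext ω
    refine recursion_congr fun u hu => ?_
    simp [ext, hu]
  rw [hrec]
  exact this

/-- A potential that does not increase on average in any step does not increase on average along
the recursion. -/
lemma lintegral_recursion_le [IsProbabilityMeasure P]
    (hF : ∀ t, Measurable fun p : Y × E => F t p.2 p.1)
    (hW : ∀ t, Measurable (W t)) (hind : iIndepFun W P) {V : Y → ENNReal} (hV : Measurable V)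
    (hstep : ∀ t y, ∫⁻ x, V (F t x y) ∂(P.map (W t)) ≤ V y) (y₀ : Y) (t : ℕ) :
    ∫⁻ ω, V (recursion F y₀ (fun u => W u ω) t) ∂P ≤ V y₀ := by
  induction t with
  | zero => simp [recursion]
  | succ t ih =>
    have hR : Measurable fun ω => recursion F y₀ (fun u => W u ω) t :=
      (measurable_recursion hF y₀ t).comp (measurable_pi_iff.2 hW)
    have hprod := (indepFun_iff_map_prod_eq_prod_map_map hR.aemeasurable (hW t).aemeasurable).1
      (indepFun_recursion hF hW hind y₀ t)
    have hP : IsProbabilityMeasure (P.map (W t)) :=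
      Measure.isProbabilityMeasure_map (hW t).aemeasurable
    calc ∫⁻ ω, V (recursion F y₀ (fun u => W u ω) (t + 1)) ∂P
        = ∫⁻ p : Y × E, V (F t p.2 p.1)
            ∂(P.map fun ω => (recursion F y₀ (fun u => W u ω) t, W t ω)) :=
          (lintegral_map (hV.comp (hF t)) (hR.prodMk (hW t))).symm
      _ = ∫⁻ y, ∫⁻ x, V (F t x y) ∂(P.map (W t))
            ∂(P.map fun ω => recursion F y₀ (fun u => W u ω) t) := by
          rw [hprod]
          exact lintegral_prod _ (hV.comp (hF t)).aemeasurable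
      _ ≤ ∫⁻ y, V y ∂(P.map fun ω => recursion F y₀ (fun u => W u ω) t) :=
          lintegral_mono fun y => hstep t y
      _ ≤ V y₀ := by rw [lintegral_map hV hR]; exact ih

/-- **Ville's inequality** for the potential `V` of a random recursion. -/
lemma measure_exists_le_recursion [IsProbabilityMeasure P]
    (hF : ∀ t, Measurable fun p : Y × E => F t p.2 p.1)
    (hW : ∀ t, Measurable (W t)) (hind : iIndepFun W P) {V : Y → ENNReal} (hV : Measurable V)
    (hstep : ∀ t y, ∫⁻ x, V (F t x y) ∂(P.map (W t)) ≤ V y) (y₀ : Y) (c : ENNReal) :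
    c * P {ω | ∃ t, c ≤ V (recursion F y₀ (fun u => W u ω) t)} ≤ V y₀ := by
  classical
  -- the recursion frozen as soon as the potential reaches the level `c`
  let G : ℕ → E → Y → Y := fun t x y => if c ≤ V y then y else F t x y
  have hc : MeasurableSet {y | c ≤ V y} := measurableSet_le measurable_const hV
  have hG : ∀ t, Measurable fun p : Y × E => G t p.2 p.1 := fun t =>
    Measurable.ite (measurable_fst hc) measurable_fst (hF t)
  have hGstep : ∀ t y, ∫⁻ x, V (G t x y) ∂(P.map (W t)) ≤ V y := by
    intro t y
    have hP : IsProbabilityMeasure (P.map (W t)) :=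
      Measure.isProbabilityMeasure_map (hW t).aemeasurable
    by_cases h : c ≤ V y
    · simp [G, h]
    · simpa [G, h] using hstep t y
  have hmono : Monotone fun t => {ω | c ≤ V (recursion G y₀ (fun u => W u ω) t)} := by
    refine monotone_nat_of_le_succ fun t ω hω => ?_
    simp only [Set.mem_ofPred_eq] at hω ⊢
    rw [recursion]
    simp [G, hω]
  have hsub : {ω | ∃ t, c ≤ V (recursion F y₀ (fun u => W u ω) t)}
      ⊆ ⋃ t, {ω | c ≤ V (recursion G y₀ (fun u => W u ω) t)} := by
    rintro ω ⟨t, ht⟩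
    by_contra hcon
    simp only [Set.mem_iUnion, Set.mem_ofPred_eq, not_exists] at hcon
    have heq : ∀ u, recursion G y₀ (fun u => W u ω) u = recursion F y₀ (fun u => W u ω) u := by
      intro u
      induction u with
      | zero => rfl
      | succ u ih =>
        rw [recursion, recursion, ← ih]
        exact if_neg (hcon u)
    exact hcon t (by rwa [heq])
  refine (mul_le_mul_right (measure_mono hsub) c).trans ?_
  rw [hmono.measure_iUnion, ENNReal.mul_iSup]
  refine iSup_le fun t => ?_
  have hR : Measurable fun ω => recursion G y₀ (fun u => W u ω) t :=
    (measurable_recursion hG y₀ t).comp (measurable_pi_iff.2 hW)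
  exact (mul_meas_ge_le_lintegral (hV.comp hR) c).trans
    (lintegral_recursion_le hG hW hind hV hGstep y₀ t)

end RandomRecursion

/-- **Hoeffding's lemma** for `[0, b]`-valued random variables. -/
lemma lintegral_exp_le_one {Ω : Type*} [MeasurableSpace Ω] {μ : Measure Ω} [IsProbabilityMeasure μ]
    {b : ℝ} {Z : Ω → ℝ} (hZ : AEMeasurable Z μ) (hb : ∀ᵐ ω ∂μ, Z ω ∈ Set.Icc 0 b) (l : ℝ) :
    ∫⁻ ω, ENNReal.ofReal (Real.exp (l * (Z ω - ∫ ω', Z ω' ∂μ) - l ^ 2 * b ^ 2 / 8)) ∂μ ≤ 1 := by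
  have h := hasSubgaussianMGF_of_mem_Icc hZ hb
  have hint := h.integrable_exp_mul l
  have hmgf := h.mgf_le l
  simp only [Real.exp_sub, div_eq_mul_inv (Real.exp _)]
  rw [← ofReal_integral_eq_lintegral_ofReal (hint.mul_const _)
    (ae_of_all _ fun ω => by positivity), integral_mul_const]
  rw [mgf] at hmgf
  refine ENNReal.ofReal_le_one.2 ?_
  rw [← div_eq_mul_inv, div_le_one (Real.exp_pos _)]
  refine hmgf.trans (Real.exp_le_exp.2 (le_of_eq ?_))
  simp only [sub_zero, NNReal.coe_pow, NNReal.coe_div, coe_nnnorm, Real.norm_eq_abs,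
    NNReal.coe_ofNat, div_pow, sq_abs]
  ring

end

/-! ### The anytime deviation bound -/

section

variable {K : ℕ} {b δ : ℝ} {s : Fin K → Fin K → ℝ → ℝ} {sel : ℕ → Finset (Fin K) → Fin K}

lemma run_eq_recursion (x : ℕ → Fin 2 → Fin K → ℝ) (t : ℕ) :
    run b δ s sel x t = recursion (step b δ s sel) (State.init K) x t := by
  induction t with
  | zero => rfl
  | succ t ih => rw [run, recursion, ih]

lemma argmaxSet_nonempty {A : Finset (Fin K)} (hA : A.Nonempty) (f : Fin K → EReal) :
    (argmaxSet A f).Nonempty := by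
  obtain ⟨k, hk, hmax⟩ := A.exists_max_image f hA
  exact ⟨k, by simpa [argmaxSet, hk] using hmax⟩

lemma firstArm_mem (hsel : IsTieBreak sel) (t : ℕ) {S : State K} (hS : 1 < S.active.card) :
    firstArm b sel t S ∈ S.active :=
  (Finset.mem_filter.1 (hsel t _ (argmaxSet_nonempty (Finset.card_pos.1 (by omega)) _))).1

lemma secondArm_mem_argmaxSet (hsel : IsTieBreak sel) (t : ℕ) {S : State K}
    (hS : 1 < S.active.card) :
    secondArm b δ sel t S ∈ argmaxSet (S.active.erase (firstArm b sel t S))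
      fun k => min (crossUCB b (δ / (2 * K)) S k k) (minPseudoUCB b t S k) :=
  hsel t _ (argmaxSet_nonempty (Finset.card_pos.1 (by
    rw [Finset.card_erase_of_mem (firstArm_mem hsel t hS)]; omega)) _)

lemma secondArm_mem (hsel : IsTieBreak sel) (t : ℕ) {S : State K} (hS : 1 < S.active.card) :
    secondArm b δ sel t S ∈ S.active.erase (firstArm b sel t S) :=
  (Finset.mem_filter.1 (secondArm_mem_argmaxSet hsel t hS)).1

lemma secondArm_ne_firstArm (hsel : IsTieBreak sel) (t : ℕ) {S : State K}
    (hS : 1 < S.active.card) : secondArm b δ sel t S ≠ firstArm b sel t S :=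
  (Finset.mem_erase.1 (secondArm_mem hsel t hS)).1

/-- The exponential potential with parameter `l` for the deviation of the total of the
pseudo-rewards of arm `ℓ` with respect to arm `k` from `m` per sample. -/
def expPotential (b m l : ℝ) (ℓ k : Fin K) (S : State K) : ENNReal :=
  ENNReal.ofReal (Real.exp
    (l * (S.total ℓ k - m * S.count k) - l ^ 2 * (b ^ 2 * S.count k / 4) / 2))

lemma measurable_expPotential (b m l : ℝ) (ℓ k : Fin K) :
    Measurable (expPotential b m l ℓ k) := by
  have : Measurable fun S : State K => (S.count k : ℝ) :=
    (measurable_of_countable (fun n : ℕ => (n : ℝ))).comp (measurable_count k)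
  unfold expPotential
  fun_prop

lemma expPotential_observe_self (m l : ℝ) (ℓ k : Fin K) (S : State K) (r : ℝ) :
    expPotential b m l ℓ k (S.observe s k r) = expPotential b m l ℓ k S *
      ENNReal.ofReal (Real.exp (l * (s ℓ k r - m) - l ^ 2 * b ^ 2 / 8)) := by
  unfold expPotential
  rw [← ENNReal.ofReal_mul (Real.exp_pos _).le, ← Real.exp_add]
  congr 2
  simp [State.observe]
  ring

lemma expPotential_observe_of_ne (m l : ℝ) {ℓ k j : Fin K} (hj : k ≠ j) (S : State K) (r : ℝ) :
    expPotential b m l ℓ k (S.observe s j r) = expPotential b m l ℓ k S := by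
  simp [expPotential, State.observe, hj]

/-- The exponential potential is a supermartingale along the run: in each round, arm `k` is sampled
through at most one of the two draws, and only the law `ν` of that single draw matters. -/
lemma lintegral_expPotential_step_le (hsel : IsTieBreak sel)
    (hs : ∀ ℓ k, Measurable (s ℓ k)) {ν : Measure (Fin K → ℝ)}
    {ρ : Measure (Fin 2 → Fin K → ℝ)} [IsProbabilityMeasure ρ]
    (hρ : ∀ i, ρ.map (fun x => x i) = ν) {m l : ℝ} {ℓ k : Fin K}
    (hν : ∫⁻ r, ENNReal.ofReal (Real.exp (l * (s ℓ k (r k) - m) - l ^ 2 * b ^ 2 / 8)) ∂ν ≤ 1)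
    (t : ℕ) (S : State K) :
    ∫⁻ x, expPotential b m l ℓ k (step b δ s sel t x S) ∂ρ ≤ expPotential b m l ℓ k S := by
  by_cases hS : 1 < S.active.card
  · have hmeas : Measurable fun r : Fin K → ℝ =>
        ENNReal.ofReal (Real.exp (l * (s ℓ k (r k) - m) - l ^ 2 * b ^ 2 / 8)) := by
      have := (hs ℓ k).comp (measurable_pi_apply (X := fun _ : Fin K => ℝ) k)
      simp only [Function.comp_def] at this
      fun_prop
    have hint : ∀ i : Fin 2, ∫⁻ x, expPotential b m l ℓ k S *
        ENNReal.ofReal (Real.exp (l * (s ℓ k (x i k) - m) - l ^ 2 * b ^ 2 / 8)) ∂ρ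
          ≤ expPotential b m l ℓ k S := by
      intro i
      have hmap := lintegral_map (μ := ρ) hmeas
        (measurable_pi_apply (X := fun _ : Fin 2 => Fin K → ℝ) i)
      rw [hρ i] at hmap
      rw [lintegral_const_mul' (expPotential b m l ℓ k S) _ ENNReal.ofReal_ne_top]
      exact mul_le_of_le_one_right' (hmap.symm.trans_le hν)
    have helim : ∀ T : State K, expPotential b m l ℓ k (T.eliminate b (δ / (2 * K)))
        = expPotential b m l ℓ k T := fun _ => rfl
    have hne := secondArm_ne_firstArm (b := b) (δ := δ) hsel t hS
    simp only [step, if_pos hS, helim]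
    by_cases h1 : k = firstArm b sel t S
    · have h2 : k ≠ secondArm b δ sel t S := fun h => hne (h.symm.trans h1)
      simp only [expPotential_observe_of_ne m l h2]
      rw [← h1]
      simpa only [expPotential_observe_self] using hint 0
    · by_cases h2 : k = secondArm b δ sel t S
      · rw [← h2]
        simpa only [expPotential_observe_self, expPotential_observe_of_ne m l h1] using hint 1
      · simp [expPotential_observe_of_ne m l h1, expPotential_observe_of_ne m l h2]
  · simp [step, hS]

/-- The one-sided anytime deviation bound: with probability at least `1 - α`, the deviation stays
below the stitched boundary from the moment on when the variance proxy `b² n / 4` reaches `1`. -/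
lemma measure_exists_boundary_le_le {Ω : Type*} [MeasurableSpace Ω] {P : Measure Ω}
    [IsProbabilityMeasure P] (hsel : IsTieBreak sel) (hs : ∀ ℓ k, Measurable (s ℓ k))
    {ν : Measure (Fin K → ℝ)} {W : ℕ → Ω → Fin 2 → Fin K → ℝ} (hW : ∀ t, Measurable (W t))
    (hlaw : ∀ t i, P.map (fun ω => W t ω i) = ν) (hind : iIndepFun W P) {m ε : ℝ}
    (hε : ε ^ 2 = 1) {ℓ k : Fin K}
    (hν : ∀ l, 0 ≤ l → ∫⁻ r, ENNReal.ofReal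
      (Real.exp (ε * l * (s ℓ k (r k) - m) - (ε * l) ^ 2 * b ^ 2 / 8)) ∂ν ≤ 1)
    {α : ℝ} (hα : 0 < α) (hα1 : α < 1) :
    P {ω | ∃ t, ∃ S, S = run b δ s sel (fun u => W u ω) t ∧ 4 ≤ b ^ 2 * S.count k ∧
      1.7 * √(b ^ 2 * S.count k / 4 * (Real.log (Real.log (2 * (b ^ 2 * S.count k / 4)))
        + 0.72 * Real.log (5.2 / α))) ≤ ε * (S.total ℓ k - m * S.count k)}
      ≤ ENNReal.ofReal α := by
  have hville : ∀ i : ℕ, P {ω | ∃ t, ENNReal.ofReal (1 / (α * epochWeight i)) ≤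
      expPotential b m (ε * epochSlope α i) ℓ k (run b δ s sel (fun u => W u ω) t)}
        ≤ ENNReal.ofReal (α * epochWeight i) := by
    intro i
    have hw : 0 < α * epochWeight i := mul_pos hα (epochWeight_pos i)
    have hstep : ∀ t S, ∫⁻ x, expPotential b m (ε * epochSlope α i) ℓ k (step b δ s sel t x S)
        ∂(P.map (W t)) ≤ expPotential b m (ε * epochSlope α i) ℓ k S := by
      intro t S
      have hP : IsProbabilityMeasure (P.map (W t)) :=
        Measure.isProbabilityMeasure_map (hW t).aemeasurable
      refine lintegral_expPotential_step_le hsel hs (ν := ν) (fun j => ?_)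
        (hν _ (Real.sqrt_nonneg _)) t S
      rw [Measure.map_map (measurable_pi_apply j) (hW t)]
      exact hlaw t j
    have h := measure_exists_le_recursion (P := P) (fun t => measurable_step b δ sel hs t) hW hind
      (measurable_expPotential b m (ε * epochSlope α i) ℓ k) hstep (State.init K)
      (ENNReal.ofReal (1 / (α * epochWeight i)))
    simp only [← run_eq_recursion] at h
    have hinit : expPotential b m (ε * epochSlope α i) ℓ k (State.init K) = 1 := by
      simp [expPotential, State.init]
    rw [hinit, one_div, ENNReal.ofReal_inv_of_pos hw, ← ENNReal.div_eq_inv_mul,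
      ENNReal.div_le_iff (by simpa using hw) ENNReal.ofReal_ne_top, one_mul] at h
    rw [one_div, ENNReal.ofReal_inv_of_pos hw]
    exact h
  calc _ ≤ P (⋃ i : ℕ, {ω | ∃ t, ENNReal.ofReal (1 / (α * epochWeight i)) ≤
        expPotential b m (ε * epochSlope α i) ℓ k (run b δ s sel (fun u => W u ω) t)}) := by
        refine measure_mono ?_
        rintro ω ⟨t, S, rfl, hn, hD⟩
        set S := run b δ s sel (fun u => W u ω) t
        obtain ⟨i, hi1, hi2⟩ := exists_nat_pow_near (x := b ^ 2 * S.count k / 4) (y := 2)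
          (by linarith) (by norm_num)
        refine Set.mem_iUnion.2 ⟨i, t, ENNReal.ofReal_le_ofReal ?_⟩
        have h := log_le_of_boundary_le hα hα1 hi1 hi2.le hD
        rw [← Real.log_le_iff_le_exp (one_div_pos.2 (mul_pos hα (epochWeight_pos i)))]
        refine h.trans (le_of_eq ?_)
        rw [mul_pow, hε]
        ring
    _ ≤ ∑' i : ℕ, ENNReal.ofReal (α * epochWeight i) :=
        (measure_iUnion_le _).trans (ENNReal.tsum_le_tsum hville)
    _ ≤ ENNReal.ofReal α := by
        refine ENNReal.tsum_le_of_sum_range_le fun N => ?_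
        rw [← ENNReal.ofReal_sum_of_nonneg fun i _ => (mul_pos hα (epochWeight_pos i)).le,
          ← Finset.mul_sum]
        exact ENNReal.ofReal_le_ofReal (mul_le_of_le_one_right hα.le (sum_epochWeight_le N))

end

/-! ### Termination on the event that all bounds are valid -/

section

open Filter Topology

variable {K : ℕ} {b δ : ℝ} {s : Fin K → Fin K → ℝ → ℝ} {sel : ℕ → Finset (Fin K) → Fin K}

/-- The value of `confWidth` in the range where it is finite. -/
def confRadius (b : ℝ) (n : ℕ) (α : ℝ) : ℝ :=
  1.7 * b / 2 * √((Real.log (Real.log (b ^ 2 * n / 2)) + 0.72 * Real.log (5.2 / α)) / n)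

lemma confWidth_eq {α : ℝ} {n : ℕ} (hn : 4 ≤ b ^ 2 * n) :
    confWidth b n α = (confRadius b n α : EReal) := if_pos hn

lemma confWidth_eq_top {α : ℝ} {n : ℕ} (hn : ¬ 4 ≤ b ^ 2 * n) : confWidth b n α = ⊤ := if_neg hn

lemma tendsto_confRadius (hb : 0 < b) (α : ℝ) :
    Tendsto (fun n : ℕ => confRadius b n α) atTop (𝓝 0) := by
  have hlin : Tendsto (fun n : ℕ => b ^ 2 * (n : ℝ) / 2) atTop atTop :=
    (tendsto_natCast_atTop_atTop.const_mul_atTop (by positivity)).atTop_div_const (by norm_num)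
  have hll : Tendsto (fun x : ℝ => Real.log (Real.log x) / x) atTop (𝓝 0) :=
    ((Real.isLittleO_log_id_atTop.comp_tendsto Real.tendsto_log_atTop).trans
      Real.isLittleO_log_id_atTop).tendsto_div_nhds_zero
  have h1 := (hll.comp hlin).mul_const (b ^ 2 / 2)
  have h2 : Tendsto (fun n : ℕ => 0.72 * Real.log (5.2 / α) / (n : ℝ)) atTop (𝓝 0) :=
    tendsto_natCast_atTop_atTop.const_div_atTop _
  have h3 : Tendsto (fun n : ℕ => (Real.log (Real.log (b ^ 2 * n / 2))
      + 0.72 * Real.log (5.2 / α)) / n) atTop (𝓝 0) := by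
    have := h1.add h2
    rw [zero_mul, zero_add] at this
    refine this.congr' ?_
    filter_upwards [eventually_gt_atTop 0] with n hn
    have hn' : (n : ℝ) ≠ 0 := by positivity
    simp only [Function.comp_apply]
    field_simp
  have h4 := ((Real.continuous_sqrt.tendsto 0).comp h3).const_mul (1.7 * b / 2)
  rw [Real.sqrt_zero, mul_zero] at h4
  exact h4

lemma step_of_lt {t : ℕ} {x : Fin 2 → Fin K → ℝ} {S : State K} (hS : 1 < S.active.card) :
    step b δ s sel t x S = ((S.observe s (firstArm b sel t S) (x 0 (firstArm b sel t S))).observe s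
      (secondArm b δ sel t S) (x 1 (secondArm b δ sel t S))).eliminate b (δ / (2 * K)) := if_pos hS

lemma active_step_subset (t : ℕ) (x : Fin 2 → Fin K → ℝ) (S : State K) :
    (step b δ s sel t x S).active ⊆ S.active := by
  by_cases hS : 1 < S.active.card
  · rw [step_of_lt hS]
    exact Finset.filter_subset _ _
  · simp [step, hS]

lemma mem_active_step {t : ℕ} {x : Fin 2 → Fin K → ℝ} {S : State K} (hS : 1 < S.active.card)
    {k : Fin K} : k ∈ (step b δ s sel t x S).active ↔ k ∈ S.active ∧
      ∀ j ∈ S.active, lcb b (δ / (2 * K)) (step b δ s sel t x S) j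
        ≤ minCrossUCB b (δ / (2 * K)) (step b δ s sel t x S) k := by
  rw [step_of_lt hS]
  simp only [State.eliminate, Finset.mem_filter, Finset.lt_sup_iff, not_exists, not_and, not_lt]
  rfl

lemma count_step_of_sampled (hsel : IsTieBreak sel) {t : ℕ} {x : Fin 2 → Fin K → ℝ} {S : State K}
    (hS : 1 < S.active.card) {k : Fin K} (hk : k = firstArm b sel t S ∨ k = secondArm b δ sel t S) :
    (step b δ s sel t x S).count k = S.count k + 1 := by
  have hne := secondArm_ne_firstArm (b := b) (δ := δ) hsel t hS
  rw [step_of_lt hS]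
  rcases hk with rfl | rfl
  · simp [State.eliminate, State.observe, hne.symm]
  · simp [State.eliminate, State.observe, hne]

lemma step_of_not_sampled {t : ℕ} {x : Fin 2 → Fin K → ℝ} {S : State K}
    {k : Fin K} (h1 : k ≠ firstArm b sel t S) (h2 : k ≠ secondArm b δ sel t S) :
    (step b δ s sel t x S).count k = S.count k ∧
      ∀ ℓ, (step b δ s sel t x S).total ℓ k = S.total ℓ k := by
  by_cases hS : 1 < S.active.card
  · rw [step_of_lt hS]
    simp [State.eliminate, State.observe, h1, h2]
  · simp [step, hS]

lemma exists_frequently_eq {m : ℕ → Fin K} : ∃ k, ∃ᶠ t in atTop, m t = k := by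
  by_contra! h
  obtain ⟨t, ht⟩ := (eventually_all.2 h).exists
  exact ht (m t) rfl

/-- If all confidence bounds for the best arm from above and for all arms from below are valid at
all times, then the algorithm stops and declares the best arm. -/
theorem stopsWith_of_bounds (hb : 0 < b) (hsel : IsTieBreak sel) {kstar : Fin K} {μ : Fin K → ℝ}
    (hμ : ∀ k, k ≠ kstar → μ k < μ kstar) {x : ℕ → Fin 2 → Fin K → ℝ}
    (hU : ∀ t k, (μ kstar : EReal) ≤ crossUCB b (δ / (2 * K)) (run b δ s sel x t) kstar k)
    (hL : ∀ t k, lcb b (δ / (2 * K)) (run b δ s sel x t) k ≤ (μ k : EReal)) :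
    StopsWith b δ s sel x kstar := by
  by_contra hnever
  set α := δ / (2 * K) with hα
  set S : ℕ → State K := fun t => run b δ s sel x t with hSdef
  have hsucc : ∀ t, S (t + 1) = step b δ s sel t (x t) (S t) := fun _ => rfl
  have hmono : Antitone fun t => (S t).active := antitone_nat_of_succ_le fun t => by
    rw [hsucc]; exact active_step_subset t _ _
  have hbest : ∀ t, kstar ∈ (S t).active := by
    intro t
    induction t with
    | zero => exact Finset.mem_univ _
    | succ t ih =>
      by_cases hS : 1 < (S t).active.card
      · rw [hsucc, mem_active_step hS]
        refine ⟨ih, fun j _ => ?_⟩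
        have hj : μ j ≤ μ kstar := by
          by_cases h : j = kstar
          · rw [h]
          · exact (hμ j h).le
        exact (hL (t + 1) j).trans ((EReal.coe_le_coe_iff.2 hj).trans
          (le_iInf fun k => hU (t + 1) k))
      · rw [hsucc, step, if_neg hS]
        exact ih
  have hcard : ∀ t, 1 < (S t).active.card := by
    intro t
    by_contra h
    have h1 : (S t).active.card = 1 := le_antisymm (not_lt.1 h) (Finset.card_pos.2 ⟨_, hbest t⟩)
    obtain ⟨k, hk⟩ := Finset.card_eq_one.1 h1
    have := hbest t
    rw [hk, Finset.mem_singleton] at this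
    exact hnever ⟨t, by rw [this]; exact hk⟩
  set m₁ : ℕ → Fin K := fun t => firstArm b sel t (S t) with hm1
  set m₂ : ℕ → Fin K := fun t => secondArm b δ sel t (S t) with hm2
  have hcount_mono : ∀ k, Monotone fun t => (S t).count k := fun k => monotone_nat_of_le_succ
    fun t => by
      by_cases h : k = m₁ t ∨ k = m₂ t
      · rw [hsucc, count_step_of_sampled hsel (hcard t) h]; omega
      · push Not at h
        rw [hsucc, (step_of_not_sampled h.1 h.2).1]
  -- an arm is sampled infinitely often, or no longer sampled from some round on
  have hdich : ∀ k, Tendsto (fun t => (S t).count k) atTop atTop ∨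
      ∀ᶠ t in atTop, k ≠ m₁ t ∧ k ≠ m₂ t := by
    intro k
    rcases tendsto_atTop_of_monotone (hcount_mono k) with h | ⟨n, hn⟩
    · exact Or.inl h
    · right
      rw [nhds_discrete, tendsto_pure] at hn
      filter_upwards [hn, (tendsto_add_atTop_nat 1).eventually hn] with t h1 h2
      by_contra hcon
      have hor : k = m₁ t ∨ k = m₂ t := by tauto
      rw [hsucc, count_step_of_sampled hsel (hcard t) hor] at h2
      omega
  have hinf : ∀ k, (∃ᶠ t in atTop, k = m₁ t ∨ k = m₂ t) →
      Tendsto (fun t => (S t).count k) atTop atTop := fun k hk =>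
    (hdich k).resolve_right fun h => hk (h.mono fun t ht => by tauto)
  -- the confidence interval of an arm that is sampled infinitely often shrinks to a point
  have hrad : ∀ k, Tendsto (fun t => (S t).count k) atTop atTop → ∀ c > 0,
      ∀ᶠ t in atTop, 4 ≤ b ^ 2 * (S t).count k ∧ confRadius b ((S t).count k) α < c := by
    intro k hk c hc
    have h1 : Tendsto (fun t => b ^ 2 * ((S t).count k : ℝ)) atTop atTop :=
      (tendsto_natCast_atTop_atTop.comp hk).const_mul_atTop (by positivity)
    exact (h1.eventually_ge_atTop 4).and
      (((tendsto_confRadius hb α).comp hk).eventually_lt_const hc)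
  have hUreal : ∀ t ℓ, 4 ≤ b ^ 2 * (S t).count ℓ →
      μ kstar ≤ empPseudo (S t) kstar ℓ + confRadius b ((S t).count ℓ) α := by
    intro t ℓ hn
    have := hU t ℓ
    rw [crossUCB, confWidth_eq hn, ← EReal.coe_add, EReal.coe_le_coe_iff] at this
    exact this
  have hLreal : ∀ t k, 4 ≤ b ^ 2 * (S t).count k →
      empPseudo (S t) k k - confRadius b ((S t).count k) α ≤ μ k := by
    intro t k hn
    have := hL t k
    rw [lcb, confWidth_eq hn, ← EReal.coe_sub, EReal.coe_le_coe_iff] at this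
    exact this
  have hUk : ∀ k, Tendsto (fun t => (S t).count k) atTop atTop → ∀ c, μ k < c →
      ∀ᶠ t in atTop, crossUCB b α (S t) k k < (c : EReal) := by
    intro k hk c hc
    filter_upwards [hrad k hk ((c - μ k) / 2) (by linarith)] with t ht
    rw [crossUCB, confWidth_eq ht.1, ← EReal.coe_add, EReal.coe_lt_coe_iff]
    linarith [hLreal t k ht.1, ht.2]
  rcases hdich kstar with hinfstar | hfin
  · -- the best arm and some other arm are sampled infinitely often, and the latter is eliminated
    obtain ⟨k, hk⟩ := exists_frequently_eq (m := fun t => if m₁ t = kstar then m₂ t else m₁ t)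
    have hkstar : k ≠ kstar := by
      obtain ⟨t, ht⟩ := hk.exists
      rintro rfl
      split_ifs at ht with h
      · exact secondArm_ne_firstArm hsel t (hcard t) (ht.trans h.symm)
      · exact h ht
    have hsampled : ∃ᶠ t in atTop, k = m₁ t ∨ k = m₂ t := hk.mono fun t ht => by
      split_ifs at ht
      · exact Or.inr ht.symm
      · exact Or.inl ht.symm
    have hactive : ∀ t, k ∈ (S t).active := by
      intro t
      obtain ⟨u, hu, hut⟩ := (hsampled.and_eventually (eventually_ge_atTop t)).exists
      refine hmono hut ?_
      rcases hu with rfl | rfl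
      · exact firstArm_mem hsel u (hcard u)
      · exact (Finset.mem_erase.1 (secondArm_mem hsel u (hcard u))).2
    have hgap := hμ k hkstar
    obtain ⟨t, ⟨h1, h2, h3⟩, ht⟩ := (((hUk k (hinf k hsampled) ((μ k + μ kstar) / 2)
      (by linarith)).and (hrad kstar hinfstar ((μ kstar - μ k) / 4) (by linarith))).and
      (eventually_ge_atTop 1)).exists
    obtain ⟨u, rfl⟩ : ∃ u, t = u + 1 := ⟨t - 1, by omega⟩
    have hkeep := ((mem_active_step (hcard u)).1 (hactive (u + 1))).2 kstar (hbest u)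
    have hlt : (((μ k + μ kstar) / 2 : ℝ) : EReal) ≤ lcb b α (S (u + 1)) kstar := by
      rw [lcb, confWidth_eq h2, ← EReal.coe_sub, EReal.coe_le_coe_iff]
      linarith [hUreal (u + 1) kstar h2]
    exact absurd (hlt.trans (hkeep.trans (iInf_le _ k))) (not_le.2 h1)
  · -- some suboptimal arm is the second choice infinitely often, although the index of the best
    -- arm exceeds its index in the long run
    obtain ⟨k, hk⟩ := exists_frequently_eq (m := m₂)
    have hinfk := hinf k (hk.mono fun t ht => Or.inr ht.symm)
    have hkstar : k ≠ kstar := by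
      obtain ⟨t, ht, hf⟩ := (hk.and_eventually hfin).exists
      rintro rfl
      exact hf.2 ht.symm
    have hgap := hμ k hkstar
    set c := (μ k + μ kstar) / 2 with hc
    have hpseudo : ∀ ℓ, ∀ᶠ t in atTop, (c : EReal) ≤ pseudoUCB b t (S t) kstar ℓ := by
      intro ℓ
      rcases hdich ℓ with hℓ | hℓ
      · filter_upwards [hrad ℓ hℓ (μ kstar - c) (by linarith)] with t ht
        unfold pseudoUCB
        split_ifs
        · exact le_top
        · have : 0 ≤ b * √(2 * Real.log t / (S t).count ℓ) := by positivity
          rw [EReal.coe_le_coe_iff]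
          linarith [hUreal t ℓ ht.1, ht.2]
      · obtain ⟨T, hT⟩ := eventually_atTop.1 hℓ
        have hconst : ∀ t ≥ T, (S t).count ℓ = (S T).count ℓ ∧
            (S t).total kstar ℓ = (S T).total kstar ℓ := by
          intro t ht
          induction t, ht using Nat.le_induction with
          | base => exact ⟨rfl, rfl⟩
          | succ t ht ih =>
            have h := step_of_not_sampled (s := s) (x := x t) (hT t ht).1 (hT t ht).2
            rw [hsucc]
            exact ⟨h.1.trans ih.1, (h.2 kstar).trans ih.2⟩
        by_cases h0 : (S T).count ℓ = 0
        · filter_upwards [eventually_ge_atTop T] with t ht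
          rw [pseudoUCB, if_pos ((hconst t ht).1.trans h0)]
          exact le_top
        · have hpos : (0 : ℝ) < (S T).count ℓ := by
            exact_mod_cast Nat.pos_of_ne_zero h0
          have hlim : Tendsto (fun t : ℕ => b * √(2 * Real.log t / (S T).count ℓ)) atTop atTop :=
            (Real.tendsto_sqrt_atTop.comp ((((Real.tendsto_log_atTop.comp
              tendsto_natCast_atTop_atTop).const_mul_atTop two_pos)).atTop_div_const
              hpos)).const_mul_atTop hb
          filter_upwards [eventually_ge_atTop T,
            hlim.eventually_ge_atTop (c - empPseudo (S T) kstar ℓ)] with t ht hlarge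
          rw [pseudoUCB, if_neg (by rw [(hconst t ht).1]; exact h0), EReal.coe_le_coe_iff,
            empPseudo, (hconst t ht).1, (hconst t ht).2]
          unfold empPseudo at hlarge
          linarith
    obtain ⟨t, ht, ⟨h1, h2⟩, h3⟩ := (hk.and_eventually ((hfin.and
      (hUk k hinfk c (by linarith))).and (eventually_all.2 hpseudo))).exists
    have hmax := (Finset.mem_filter.1 (secondArm_mem_argmaxSet (b := b) (δ := δ) hsel t
      (hcard t))).2 kstar (Finset.mem_erase.2 ⟨h1.1, hbest t⟩)
    have hm2k : secondArm b δ sel t (S t) = k := ht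
    rw [hm2k] at hmax
    have hcle : (c : EReal) ≤ min (crossUCB b α (S t) kstar kstar)
        (minPseudoUCB b t (S t) kstar) :=
      le_min ((EReal.coe_le_coe_iff.2 (by linarith)).trans (hU t kstar)) (le_iInf h3)
    exact absurd (hcle.trans (hmax.trans (min_le_left _ _))) (not_le.2 h2)

end

/-! ### Validity of the confidence bounds -/

section

variable {K : ℕ} {b δ : ℝ} {s : Fin K → Fin K → ℝ → ℝ} {sel : ℕ → Finset (Fin K) → Fin K}
  {ν : Measure (Fin K → ℝ)} [IsProbabilityMeasure ν]

/-- The shortfall of the pseudo-rewards below the mean of the arm is sub-Gaussian with the same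
proxy `b² / 4` as a `[0, b]`-valued variable, although the pseudo-rewards may be unbounded: they
dominate the conditional expectation, which is `[0, b]`-valued and has the same mean. -/
lemma lintegral_exp_pseudoReward_le_one (hν : ∀ᵐ r ∂ν, ∀ k, r k ∈ Set.Icc (0 : ℝ) b)
    (hs : IsPseudoReward b ν s) (ℓ k : Fin K) {l : ℝ} (hl : 0 ≤ l) :
    ∫⁻ r, ENNReal.ofReal (Real.exp (-1 * l * (s ℓ k (r k) - ∫ r, r ℓ ∂ν)
      - (-1 * l) ^ 2 * b ^ 2 / 8)) ∂ν ≤ 1 := by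
  have hbd : ∀ᵐ r ∂ν, r ℓ ∈ Set.Icc (0 : ℝ) b := hν.mono fun r h => h ℓ
  have hint : Integrable (fun r : Fin K → ℝ => r ℓ) ν :=
    Integrable.of_mem_Icc 0 b (measurable_pi_apply ℓ).aemeasurable hbd
  have hmle : MeasurableSpace.comap (fun r : Fin K → ℝ => r k) inferInstance
      ≤ (MeasurableSpace.pi : MeasurableSpace (Fin K → ℝ)) := (measurable_pi_apply k).comap_le
  set g := ν[(fun r : Fin K → ℝ => r ℓ) |
    MeasurableSpace.comap (fun r : Fin K → ℝ => r k) inferInstance] with hg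
  have hg0 : ∀ᵐ r ∂ν, 0 ≤ g r := condExp_nonneg (hbd.mono fun r h => h.1)
  have hgb : ∀ᵐ r ∂ν, g r ≤ b := by
    have := condExp_mono (m := MeasurableSpace.comap (fun r : Fin K → ℝ => r k) inferInstance) hint (integrable_const b) (hbd.mono fun r h => h.2)
    rw [condExp_const hmle] at this
    exact this
  have hgI : ∀ᵐ r ∂ν, g r ∈ Set.Icc 0 b := by
    filter_upwards [hg0, hgb] with r h0 h1 using ⟨h0, h1⟩
  have hmean : ∫ r, g r ∂ν = ∫ r, r ℓ ∂ν := integral_condExp hmle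
  have hhoeff := lintegral_exp_le_one integrable_condExp.aestronglyMeasurable.aemeasurable hgI
    (-1 * l)
  rw [hmean] at hhoeff
  refine le_trans (lintegral_mono_ae ?_) hhoeff
  filter_upwards [hs.condExp_le ℓ k] with r hr
  refine ENNReal.ofReal_le_ofReal (Real.exp_le_exp.2 ?_)
  have : g r ≤ s ℓ k (r k) := hr
  nlinarith [mul_le_mul_of_nonneg_left this hl]

lemma lintegral_exp_reward_le_one (hν : ∀ᵐ r ∂ν, ∀ k, r k ∈ Set.Icc (0 : ℝ) b)
    (hs : IsPseudoReward b ν s) (k : Fin K) (l : ℝ) :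
    ∫⁻ r, ENNReal.ofReal (Real.exp (1 * l * (s k k (r k) - ∫ r, r k ∂ν)
      - (1 * l) ^ 2 * b ^ 2 / 8)) ∂ν ≤ 1 := by
  have hhoeff := lintegral_exp_le_one (measurable_pi_apply k).aemeasurable
    (hν.mono fun r h => h k) (1 * l)
  refine le_trans (le_of_eq (lintegral_congr_ae ?_)) hhoeff
  filter_upwards [hν] with r hr
  rw [hs.self k _ (hr k)]

lemma natCast_mul_confRadius (hb : 0 < b) {n : ℕ} (hn : 0 < n) (α : ℝ) :
    n * confRadius b n α = 1.7 * √(b ^ 2 * n / 4 *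
      (Real.log (Real.log (2 * (b ^ 2 * n / 4))) + 0.72 * Real.log (5.2 / α))) := by
  have hn' : (0 : ℝ) < n := by exact_mod_cast hn
  have e : b ^ 2 * n / 4 * (Real.log (Real.log (2 * (b ^ 2 * n / 4))) + 0.72 * Real.log (5.2 / α))
      = (b / 2 * n) ^ 2 *
        ((Real.log (Real.log (b ^ 2 * n / 2)) + 0.72 * Real.log (5.2 / α)) / n) := by
    rw [show 2 * (b ^ 2 * n / 4) = b ^ 2 * (n : ℝ) / 2 by ring]
    field_simp
    ring
  rw [e, Real.sqrt_mul (sq_nonneg _), Real.sqrt_sq (by positivity), confRadius]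
  ring

lemma boundary_le_of_crossUCB_lt (hb : 0 < b) {α m : ℝ} {S : State K} {ℓ k : Fin K}
    (h : crossUCB b α S ℓ k < (m : EReal)) : 4 ≤ b ^ 2 * S.count k ∧
      1.7 * √(b ^ 2 * S.count k / 4 * (Real.log (Real.log (2 * (b ^ 2 * S.count k / 4)))
        + 0.72 * Real.log (5.2 / α))) ≤ -1 * (S.total ℓ k - m * S.count k) := by
  by_cases hn : 4 ≤ b ^ 2 * S.count k
  · have hpos : 0 < S.count k := by
      by_contra h0
      norm_num [Nat.eq_zero_of_not_pos h0] at hn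
    have hpos' : (0 : ℝ) < S.count k := by exact_mod_cast hpos
    rw [crossUCB, confWidth_eq hn, ← EReal.coe_add, EReal.coe_lt_coe_iff, empPseudo] at h
    have := mul_lt_mul_of_pos_left h hpos'
    rw [mul_add, mul_div_cancel₀ _ hpos'.ne', natCast_mul_confRadius hb hpos] at this
    exact ⟨hn, by linarith⟩
  · rw [crossUCB, confWidth_eq_top hn, EReal.coe_add_top] at h
    exact absurd h (not_lt.2 le_top)

lemma boundary_le_of_lt_lcb (hb : 0 < b) {α m : ℝ} {S : State K} {k : Fin K}
    (h : (m : EReal) < lcb b α S k) : 4 ≤ b ^ 2 * S.count k ∧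
      1.7 * √(b ^ 2 * S.count k / 4 * (Real.log (Real.log (2 * (b ^ 2 * S.count k / 4)))
        + 0.72 * Real.log (5.2 / α))) ≤ 1 * (S.total k k - m * S.count k) := by
  by_cases hn : 4 ≤ b ^ 2 * S.count k
  · have hpos : 0 < S.count k := by
      by_contra h0
      norm_num [Nat.eq_zero_of_not_pos h0] at hn
    have hpos' : (0 : ℝ) < S.count k := by exact_mod_cast hpos
    rw [lcb, confWidth_eq hn, ← EReal.coe_sub, EReal.coe_lt_coe_iff, empPseudo] at h
    have := mul_lt_mul_of_pos_left h hpos'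
    rw [mul_sub, mul_div_cancel₀ _ hpos'.ne', natCast_mul_confRadius hb hpos] at this
    exact ⟨hn, by linarith⟩
  · rw [lcb, confWidth_eq_top hn, EReal.sub_top] at h
    exact absurd h not_lt_bot

end

end CLUCB

end

theorem theorem1 {Ω : Type*} [MeasurableSpace Ω] (P : MeasureTheory.Measure Ω)
    [MeasureTheory.IsProbabilityMeasure P]
    (K : ℕ) (b δ : ℝ) (hb : 0 < b) (hδ : 0 < δ)
    -- the joint law of the rewards `(R_1, …, R_K)`
    (ν : MeasureTheory.Measure (Fin K → ℝ)) [MeasureTheory.IsProbabilityMeasure ν]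
    (hν : ∀ᵐ r ∂ν, ∀ k, r k ∈ Set.Icc (0 : ℝ) b)
    -- the pseudo-rewards
    (s : Fin K → Fin K → ℝ → ℝ) (hs : CLUCB.IsPseudoReward b ν s)
    -- the best arm
    (kstar : Fin K) (hstar : ∀ k, k ≠ kstar → ∫ r, r k ∂ν < ∫ r, r kstar ∂ν)
    -- the reward vectors: in each round two draws from `ν` (possibly dependent, possibly equal),
    -- independently over the rounds
    (X : ℕ → Fin 2 → Ω → Fin K → ℝ)
    (hX : ∀ t i, Measurable (X t i))
    (hlaw : ∀ t i, P.map (X t i) = ν)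
    (hindep : ProbabilityTheory.iIndepFun (fun t ω i => X t i ω) P)
    -- an arbitrary rule for breaking ties in the two maximizations
    (sel : ℕ → Finset (Fin K) → Fin K) (hsel : CLUCB.IsTieBreak sel) :
    1 - δ ≤ P.real {ω | CLUCB.StopsWith b δ s sel (fun t i => X t i ω) kstar} := by
  rcases le_or_gt 1 δ with hδ1 | hδ1
  · exact (sub_nonpos.2 hδ1).trans MeasureTheory.measureReal_nonneg
  have hK : (1 : ℝ) ≤ K := by exact_mod_cast Fin.pos kstar
  have hα : 0 < δ / (2 * K) := by positivity
  have hα1 : δ / (2 * K) < 1 := by rw [div_lt_one (by positivity)]; linarith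
  have hW : ∀ t, Measurable fun ω i => X t i ω := fun t => measurable_pi_iff.2 (hX t)
  let S : Ω → ℕ → CLUCB.State K := fun ω => CLUCB.run b δ s sel fun t i => X t i ω
  -- the bound from above on the best arm through the samples of arm `k` fails at some time
  let badU : Fin K → Set Ω := fun k =>
    {ω | ∃ t, CLUCB.crossUCB b (δ / (2 * K)) (S ω t) kstar k < ((∫ r, r kstar ∂ν : ℝ) : EReal)}
  -- the bound from below on arm `k` fails at some time
  let badL : Fin K → Set Ω := fun k =>
    {ω | ∃ t, ((∫ r, r k ∂ν : ℝ) : EReal) < CLUCB.lcb b (δ / (2 * K)) (S ω t) k}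
  have hbadU : ∀ k, P (badU k) ≤ ENNReal.ofReal (δ / (2 * K)) := fun k =>
    le_trans (MeasureTheory.measure_mono fun ω hω => by
      obtain ⟨t, ht⟩ := hω
      exact ⟨t, _, rfl, CLUCB.boundary_le_of_crossUCB_lt hb ht⟩)
    (CLUCB.measure_exists_boundary_le_le (b := b) (δ := δ) hsel hs.measurable hW hlaw hindep
      (by norm_num) (fun l hl => CLUCB.lintegral_exp_pseudoReward_le_one hν hs kstar k hl) hα hα1)
  have hbadL : ∀ k, P (badL k) ≤ ENNReal.ofReal (δ / (2 * K)) := fun k =>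
    le_trans (MeasureTheory.measure_mono fun ω hω => by
      obtain ⟨t, ht⟩ := hω
      exact ⟨t, _, rfl, CLUCB.boundary_le_of_lt_lcb hb ht⟩)
    (CLUCB.measure_exists_boundary_le_le (b := b) (δ := δ) hsel hs.measurable hW hlaw hindep
      (by norm_num) (fun l _ => CLUCB.lintegral_exp_reward_le_one hν hs k l) hα hα1)
  set A := {ω | CLUCB.StopsWith b δ s sel (fun t i => X t i ω) kstar} with hA
  have hcompl : Aᶜ ⊆ ⋃ k, badU k ∪ badL k := by
    intro ω hω
    by_contra hcon
    simp only [Set.mem_iUnion, Set.mem_union, not_exists, not_or] at hcon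
    refine hω (CLUCB.stopsWith_of_bounds hb hsel (μ := fun k => ∫ r, r k ∂ν) hstar ?_ ?_)
    · exact fun t k => not_lt.1 fun h => (hcon k).1 ⟨t, h⟩
    · exact fun t k => not_lt.1 fun h => (hcon k).2 ⟨t, h⟩
  have hPc : P.real Aᶜ ≤ δ := by
    have hle : P Aᶜ ≤ ENNReal.ofReal δ := by
      calc P Aᶜ ≤ ∑ k, P (badU k ∪ badL k) :=
            (MeasureTheory.measure_mono hcompl).trans (MeasureTheory.measure_iUnion_fintype_le _ _)
        _ ≤ ∑ _k : Fin K, ENNReal.ofReal (δ / K) := by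
            refine Finset.sum_le_sum fun k _ => (MeasureTheory.measure_union_le _ _).trans ?_
            refine (add_le_add (hbadU k) (hbadL k)).trans (le_of_eq ?_)
            rw [← ENNReal.ofReal_add hα.le hα.le]
            congr 1
            field_simp
            norm_num
        _ = ENNReal.ofReal δ := by
            rw [Finset.sum_const, Finset.card_univ, Fintype.card_fin, nsmul_eq_mul,
              ← ENNReal.ofReal_natCast, ← ENNReal.ofReal_mul (by positivity)]
            congr 1
            field_simp
    exact ENNReal.toReal_le_of_le_ofReal hδ.le hle
  -- the event need not be measurable, so only subadditivity of `P` is available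
  have huniv : P.real Set.univ ≤ P.real A + P.real Aᶜ := by
    rw [← Set.union_compl_self A]
    exact MeasureTheory.measureReal_union_le _ _
  rw [MeasureTheory.probReal_univ] at huniv
  linarith
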